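/- Let $\operatorname{Av}(4231,3124)$ be the class of all permutations that contain neither $4231$ nor $3124$ as a pattern, where a permutation $\pi$ contains $\sigma$ if some subsequence of the entries of $\pi$ is in the same relative order as the entries of $\sigma$. For $n\ge 1$ let $a_n$ be the number of permutations of length $n$ in this class. Then the generating function of the nonempty permutations in $\operatorname{Av}(4231,3124)$ is $$\sum_{n\ge 1} a_n x^n=\frac{1-8x+20x^2-20x^3+10x^4-2x^5-(1-4x+2x^2)\sqrt{1-4x}}{2(1-3x+x^2)(-1+5x-4x^2+x^3)},$$ as an identity of formal power series over $\mathbb{Q}$, where $\sqrt{1-4x}$ is the power series with constant term $1$ whose square is $1-4x$. -/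

import Mathlib

/-- A permutation of some length `k`, viewed as a bijection of the `k`-element chain `Fin k`. -/
abbrev Pattern : Type := Σ k : ℕ, Equiv.Perm (Fin k)

/-- The permutation `π` contains `σ`: some increasing choice of positions carries entries of `π`
that are in the same relative order as the entries of `σ`. -/
def PermContains {n k : ℕ} (π : Equiv.Perm (Fin n)) (σ : Equiv.Perm (Fin k)) : Prop :=
  ∃ e : Fin k ↪o Fin n, ∀ i j : Fin k, π (e i) < π (e j) ↔ σ i < σ j

/-- The permutations of length `n` in the class `Av(B)`: those containing no member of `B`. -/
def Av (B : Set Pattern) (n : ℕ) : Set (Equiv.Perm (Fin n)) :=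
  {π | ∀ β ∈ B, ¬ PermContains π β.2}

/-- The generating function `∑_{n ≥ 1} |Av(B)_n| x^n` of the nonempty permutations in `Av(B)`. -/
noncomputable def avGenFun (B : Set Pattern) : PowerSeries ℚ :=
  PowerSeries.mk fun n => if n = 0 then 0 else ((Av B n).ncard : ℚ)

/-- The permutation `4231`, in zero-based one-line notation. -/
def perm4231 : Equiv.Perm (Fin 4) where
  toFun := ![3, 1, 2, 0]
  invFun := ![3, 1, 2, 0]
  left_inv := by decide
  right_inv := by decide

/-- The permutation `3124`, in zero-based one-line notation. -/
def perm3124 : Equiv.Perm (Fin 4) where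
  toFun := ![2, 0, 1, 3]
  invFun := ![1, 2, 0, 3]
  left_inv := by decide
  right_inv := by decide

namespace AvTree

open PowerSeries Finset

/-! Build the permutations by inserting successive maxima. A maximum `m` may enter between `X` and
`Y` exactly when `X ++ Y` is good, `X` avoids 312 and `Y` avoids 231. Hence the admissible places
form an interval, the places in or at the ends of a middle factor `W` (`Active`). In every word
reached from `[0]`, `W` is a direct sum of decreasing layers, and all that matters is the list of
layer sizes, whether `W` reaches the right end of the word (open) or not (closed), and in the closed
case how the last layer compares with the entries to its right.

Each insertion leads to such a state again (`cnt_succ_open`, `cnt_succ_closed`), so the generating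
functions of descendants satisfy linear recursions `F = 1 + X * (sum over children)`. These
determine every coefficient from lower ones, so it is enough to exhibit solutions: `closedSer_eq`
and `openSer_eq` verify closed forms that are geometric in the labels, with ratios `cat` and `rho`,
and additive in the layers. Evaluating the open series at the root `[0]` and using `1 - 2 * X * cat`
as the square root of `1 - 4 * X` gives the formula (`closed_form`). -/

/-! ### Power series solving the recursions of the generating tree. -/

theorem mul_inv_self_of_constantCoeff {f : PowerSeries ℚ} (h : constantCoeff f = 1) :
    f * f⁻¹ = 1 :=
  PowerSeries.mul_inv_cancel f (by simp [h])

/-- The Catalan generating function over `ℚ`. -/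
noncomputable def cat : PowerSeries ℚ := catalanSeries.map (Nat.castRingHom ℚ)

theorem cat_eq : cat = 1 + X * cat ^ 2 := by
  have h := congrArg (PowerSeries.map (Nat.castRingHom ℚ)) catalanSeries_sq_mul_X_add_one
  simp only [map_add, map_mul, map_pow, PowerSeries.map_X, map_one] at h
  change cat ^ 2 * X + 1 = cat at h
  linear_combination -h

theorem constantCoeff_cat : constantCoeff cat = 1 := by
  rw [cat_eq]; simp

noncomputable def geo : PowerSeries ℚ := (1 - X)⁻¹
noncomputable def rinv : PowerSeries ℚ := (1 - X - X * cat)⁻¹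
-- The ratio by which a closed series without earlier layers grows with `p`; see `gSer_eq`.
noncomputable def rho : PowerSeries ℚ := (1 - X) * rinv
noncomputable def kap : PowerSeries ℚ := (1 - 3 * X + X ^ 2)⁻¹
noncomputable def del : PowerSeries ℚ := (2 - cat - X)⁻¹

theorem geo_mul : (1 - X) * geo = 1 :=
  mul_inv_self_of_constantCoeff (by simp)
theorem rinv_mul : (1 - X - X * cat) * rinv = 1 :=
  mul_inv_self_of_constantCoeff (by simp)
theorem kap_mul : (1 - 3 * X + X ^ 2) * kap = 1 :=
  mul_inv_self_of_constantCoeff (by simp)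
theorem del_mul : (2 - cat - X) * del = 1 :=
  mul_inv_self_of_constantCoeff (by
    rw [map_sub, map_sub, constantCoeff_cat, map_ofNat, constantCoeff_X]; norm_num)

theorem rho_mul : (1 - X - X * cat) * rho = 1 - X := by
  unfold rho; linear_combination (1 - X) * rinv_mul

theorem rho_eq : rho = 1 + X * geo * cat * rho := by
  linear_combination geo * rho_mul + (1 - rho) * geo_mul

/-- `∑_{r=1}^{p}` of the series of the closed states with label `(r, 1)`. -/
noncomputable def hSer (p : ℕ) : PowerSeries ℚ := cat ^ 2 * ∑ i ∈ range p, rho ^ (i + 1)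

noncomputable def gSer (p j : ℕ) : PowerSeries ℚ := cat ^ j * (cat + X * geo * hSer p)

/-- The contribution of the insertions into a direct sum of decreasing layers, whose sizes are
listed from the last layer to the first. -/
noncomputable def layerSer : List ℕ → PowerSeries ℚ
  | [] => 0
  | q :: S => layerSer S * geo + hSer q

noncomputable def closedSer (S : List ℕ) (p j : ℕ) : PowerSeries ℚ :=
  gSer p j + X * geo * layerSer S

/-- The solution of `α = X * (1 + α + α * geo)`, forced by comparing multiples of `layerSer S` in
`openSer_eq`. -/
noncomputable def alph : PowerSeries ℚ := X * (1 - X) * kap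

noncomputable def bCoef : PowerSeries ℚ :=
  (1 - X) ^ 2 * kap * del * cat ^ 2 * (1 - X - X * cat)

noncomputable def aCoef : PowerSeries ℚ := cat * (1 + bCoef * (X * rho - 1))

/-- Differencing the open recursion in `q` leaves a linear recurrence with homogeneous solution `cat
^ q` and a forcing term proportional to `rho ^ q`. The latter fixes `bCoef`; the case `q = 0` of
`fSer_eq` then fixes `aCoef`. -/
noncomputable def fSer (q : ℕ) : PowerSeries ℚ := aCoef * cat ^ q + bCoef * rho ^ q

noncomputable def openSer (S : List ℕ) (q : ℕ) : PowerSeries ℚ := fSer q + alph * layerSer S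

theorem sum_range_sub_add_one {M : Type*} [AddCommMonoid M] (F : ℕ → M) (n : ℕ) :
    ∑ i ∈ range n, F (n - i + 1) = ∑ i ∈ range n, F (i + 2) := by
  rw [← sum_range_reflect (fun i => F (i + 2)) n]
  refine sum_congr rfl fun i hi => ?_
  have := mem_range.1 hi
  rw [show n - 1 - i + 2 = n - i + 1 by omega]

theorem hSer_zero : hSer 0 = 0 := by simp [hSer]

theorem hSer_succ (p : ℕ) : hSer (p + 1) = hSer p + cat ^ 2 * rho ^ (p + 1) := by
  simp [hSer, sum_range_succ, mul_add]

theorem gSer_eq (p j : ℕ) : gSer p j = cat ^ (j + 1) * rho ^ p := by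
  induction p with
  | zero => simp [gSer, hSer_zero, pow_succ]
  | succ p ih =>
    unfold gSer at ih ⊢
    rw [hSer_succ]
    linear_combination ih - cat ^ (j + 1) * rho ^ p * rho_eq

theorem sum_gSer (p : ℕ) : ∑ i ∈ range p, gSer (p - i) 1 = hSer p := by
  have := sum_range_reflect (fun i => gSer (i + 1) 1) p
  rw [hSer, mul_sum]
  simp only [gSer_eq] at this ⊢
  rw [← this]
  refine sum_congr rfl fun i hi => ?_
  have := mem_range.1 hi
  rw [show p - 1 - i + 1 = p - i by omega]

/-- The combinatorial form of `layerSer`: inserting just before the last layer keeps the earlier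
layers `S`, inserting inside it deactivates them. -/
theorem layerSer_cons (S : List ℕ) (q : ℕ) :
    layerSer ((q + 1) :: S) = layerSer S +
      (closedSer S (q + 1) 1 + ∑ i ∈ range q, closedSer [] (q - i) 1) := by
  simp only [closedSer, layerSer, mul_zero, add_zero, sum_gSer, hSer_succ]
  rw [gSer_eq]
  linear_combination layerSer S * geo_mul

/-- The summands match the insertion places from left to right: in the earlier layers, before `D₁`,
inside `D₁`, before an entry of `D₂`, and after `D₂`, which then becomes a complete layer. -/
theorem closedSer_eq (S : List ℕ) (p j : ℕ) :
    closedSer S p (j + 1) = 1 + X * (layerSer S + (closedSer S p (j + 2)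
      + ∑ i ∈ range j, closedSer [] p (j - i + 1) + ∑ i ∈ range p, closedSer [] (p - i) 1
      + closedSer (if p = 0 then [] else [p]) 0 1)) := by
  have e1 : layerSer (if p = 0 then [] else [p]) = hSer p := by
    split_ifs with h
    · simp [h, layerSer, hSer_zero]
    · simp [layerSer]
  have e2 : ∑ i ∈ range j, gSer p (j - i + 1) = ∑ i ∈ range j, gSer p (i + 2) :=
    sum_range_sub_add_one _ _
  have e3 : gSer p (j + 1) = 1 + X * (gSer p (j + 2) + ∑ i ∈ range j, gSer p (i + 2) + hSer p
      + gSer 0 1 + X * geo * hSer p) := by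
    induction j with
    | zero =>
      simp only [range_zero, sum_empty, gSer, hSer_zero]
      linear_combination (1 + cat + X * geo * hSer p) * cat_eq + X * hSer p * geo_mul
    | succ j ih =>
      rw [sum_range_succ]
      have := ih (sum_range_sub_add_one _ _)
      simp only [gSer_eq] at this ⊢
      linear_combination this + (cat ^ (j + 2) * rho ^ p) * cat_eq
  simp only [closedSer, e1, e2, sum_gSer, layerSer, mul_zero, add_zero]
  linear_combination e3 + X * layerSer S * geo_mul

theorem bCoef_mul : bCoef * (rho - 1 - X * rho ^ 2) = X * alph * cat ^ 2 * rho := by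
  -- Clearing the denominator of `rho` shows why `del` enters `bCoef`.
  have h : (1 - X - X * cat) ^ 2 * (rho - 1 - X * rho ^ 2) = X ^ 2 * (2 - cat - X) := by
    linear_combination ((1 - X - X * cat) - X * ((1 - X - X * cat) * rho + (1 - X))) * rho_mul
      + X * cat_eq
  have hr : rho = (1 - X) * rinv := rfl
  have hb : bCoef = (1 - X) ^ 2 * kap * del * cat ^ 2 * (1 - X - X * cat) := rfl
  have ha : alph = X * (1 - X) * kap := rfl
  linear_combination (rho - 1 - X * rho ^ 2) * hb - X * cat ^ 2 * rho * ha
    - X ^ 2 * (1 - X) * kap * cat ^ 2 * hr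
    - ((1 - X) ^ 2 * kap * cat ^ 2 * del * (1 - X - X * cat) * (rho - 1 - X * rho ^ 2)) * rinv_mul
    + ((1 - X) ^ 2 * kap * cat ^ 2 * del * rinv) * h
    + ((1 - X) ^ 2 * kap * cat ^ 2 * X ^ 2 * rinv) * del_mul

theorem fSer_eq (q : ℕ) : fSer (q + 1) = 1 + X * (fSer (q + 2)
      + ∑ i ∈ range q, fSer (q - i + 1) + fSer 1 + alph * hSer (q + 1)) := by
  have e2 : ∑ i ∈ range q, fSer (q - i + 1) = ∑ i ∈ range q, fSer (i + 2) :=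
    sum_range_sub_add_one _ _
  rw [e2]
  clear e2
  induction q with
  | zero =>
    simp only [range_zero, sum_empty, hSer_succ, hSer_zero, fSer]
    have ha : aCoef = cat * (1 + bCoef * (X * rho - 1)) := rfl
    linear_combination (aCoef + 1 + bCoef * (X * rho - 1)) * cat_eq + bCoef_mul
      + (1 - X * cat) * ha
  | succ q ih =>
    rw [sum_range_succ, hSer_succ]
    simp only [fSer] at ih ⊢
    linear_combination ih + aCoef * cat ^ (q + 1) * cat_eq + rho ^ (q + 1) * bCoef_mul

/-- The last two kinds of child are insertions inside the last layer, which discard `S`, and the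
insertion at the right end, which completes that layer. -/
theorem openSer_eq (S : List ℕ) (q : ℕ) :
    openSer S (q + 1) = 1 + X * (layerSer S + (openSer S (q + 2)
      + ∑ i ∈ range q, openSer [] (q - i + 1) + openSer ((q + 1) :: S) 1)) := by
  have h : alph = X * (1 + alph + alph * geo) := by
    unfold alph
    linear_combination X * (kap_mul) - X ^ 2 * kap * geo_mul
  simp only [openSer, layerSer, mul_zero, add_zero]
  linear_combination fSer_eq q + layerSer S * h

theorem closed_form :
    X * openSer [] 1 * (2 * (1 - 3 * X + X ^ 2) * (-1 + 5 * X - 4 * X ^ 2 + X ^ 3)) =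
      1 - 8 * X + 20 * X ^ 2 - 20 * X ^ 3 + 10 * X ^ 4 - 2 * X ^ 5
            - (1 - 4 * X + 2 * X ^ 2) * (1 - 2 * X * cat) := by
  have hd : (-1 + 5 * X - 4 * X ^ 2 + X ^ 3) * del = X * cat - (1 - X) ^ 2 := by
    -- The cubic is, up to a factor `X`, the norm of `2 - cat - X`: the other root of the Catalan
    -- equation is `1 / X - cat`.
    have : (-1 + 5 * X - 4 * X ^ 2 + X ^ 3 : PowerSeries ℚ)
        = (2 - cat - X) * (X * cat - (1 - X) ^ 2) := by
      linear_combination -cat_eq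
    rw [this]
    linear_combination (X * cat - (1 - X) ^ 2) * del_mul
  have hb : bCoef * rho = (1 - X) ^ 3 * kap * del * cat ^ 2 := by
    unfold bCoef
    linear_combination ((1 - X) ^ 2 * kap * del * cat ^ 2) * rho_mul
  have hf : openSer [] 1 = cat ^ 2 + kap * del * ((1 - X) ^ 2 * cat ^ 4 * (X * cat - (1 - X) ^ 2)
      + (1 - X) ^ 3 * cat ^ 2) := by
    simp only [openSer, layerSer, fSer, aCoef]
    have hb' : bCoef = (1 - X) ^ 2 * kap * del * cat ^ 2 * (1 - X - X * cat) := rfl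
    linear_combination (1 + X * cat ^ 2) * hb - cat ^ 2 * hb'
  rw [hf]
  set Y := (1 - X) ^ 2 * cat ^ 4 * (X * cat - (1 - X) ^ 2) + (1 - X) ^ 3 * cat ^ 2 with hY
  -- Once `kap` and `del` are eliminated, a polynomial identity in `X` and `cat` remains; the long
  -- factor is its cofactor with respect to the Catalan equation.
  linear_combination 2 * X * Y * (-1 + 5 * X - 4 * X ^ 2 + X ^ 3) * del * kap_mul
    + 2 * X * Y * hd + 2 * X * (X * cat - (1 - X) ^ 2) * hY
    - (4 * X + 2 * X * cat - 2 * X * cat ^ 2 - 2 * X * cat ^ 3 - 18 * X ^ 2 - 10 * X ^ 2 * cat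
      + 12 * X ^ 2 * cat ^ 2 + 12 * X ^ 2 * cat ^ 3 + 2 * X ^ 2 * cat ^ 4 + 20 * X ^ 3 + 16 * X
      ^ 3 * cat - 26 * X ^ 3 * cat ^ 2 - 22 * X ^ 3 * cat ^ 3 - 4 * X ^ 3 * cat ^ 4 - 10 * X ^ 4
      - 10 * X ^ 4 * cat + 26 * X ^ 4 * cat ^ 2 + 16 * X ^ 4 * cat ^ 3 + 2 * X ^ 4 * cat ^ 4 + 2
      * X ^ 5 + 2 * X ^ 5 * cat - 12 * X ^ 5 * cat ^ 2 - 4 * X ^ 5 * cat ^ 3 + 2 * X ^ 6 * cat ^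
      2) * cat_eq

/-! ### Patterns in words and the interval of active places. -/

def Has231 (w : List ℕ) : Prop := ∃ x y z, [x, y, z].Sublist w ∧ z < x ∧ x < y
def Has312 (w : List ℕ) : Prop := ∃ x y z, [x, y, z].Sublist w ∧ y < z ∧ z < x
def Has4231 (w : List ℕ) : Prop :=
  ∃ a b c d, [a, b, c, d].Sublist w ∧ d < b ∧ b < c ∧ c < a
def Has3124 (w : List ℕ) : Prop :=
  ∃ a b c d, [a, b, c, d].Sublist w ∧ b < c ∧ c < a ∧ a < d

/-- The word contains neither `4231` nor `3124`. -/
def Good (w : List ℕ) : Prop := ¬ Has4231 w ∧ ¬ Has3124 w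

theorem Has231.mono {w w' : List ℕ} (h : w.Sublist w') : Has231 w → Has231 w' :=
  fun ⟨x, y, z, hs, hr⟩ => ⟨x, y, z, hs.trans h, hr⟩

theorem Has312.mono {w w' : List ℕ} (h : w.Sublist w') : Has312 w → Has312 w' :=
  fun ⟨x, y, z, hs, hr⟩ => ⟨x, y, z, hs.trans h, hr⟩

theorem Good.anti {w w' : List ℕ} (h : w.Sublist w') (hg : Good w') : Good w :=
  ⟨fun ⟨a, b, c, d, hs, hr⟩ => hg.1 ⟨a, b, c, d, hs.trans h, hr⟩,
    fun ⟨a, b, c, d, hs, hr⟩ => hg.2 ⟨a, b, c, d, hs.trans h, hr⟩⟩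

theorem sublist_insert {l X Y : List ℕ} {m : ℕ} (h : l.Sublist (X ++ m :: Y)) :
    l.Sublist (X ++ Y) ∨ ∃ l₁ l₂, l = l₁ ++ m :: l₂ ∧ l₁.Sublist X ∧ l₂.Sublist Y := by
  obtain ⟨l₁, l₂, rfl, h₁, h₂⟩ := List.sublist_append_iff.1 h
  rcases List.sublist_cons_iff.1 h₂ with h₂ | ⟨r, rfl, h₃⟩
  · exact .inl (h₁.append h₂)
  · exact .inr ⟨l₁, r, rfl, h₁, h₃⟩

theorem append_sublist_insert (X Y : List ℕ) (m : ℕ) : (X ++ Y).Sublist (X ++ m :: Y) :=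
  (List.Sublist.refl X).append (List.sublist_cons_self m Y)

theorem Good.not_has312 {X Y : List ℕ} {m : ℕ} (hX : ∀ x ∈ X, x < m) (h : Good (X ++ m :: Y)) :
    ¬ Has312 X := by
  rintro ⟨x, y, z, hs, h1, h2⟩
  refine h.2 ⟨x, y, z, m, ?_, h1, h2, hX _ (hs.subset (by simp))⟩
  exact hs.append (l₁ := [x, y, z]) (r₁ := [m]) (by simp)

theorem Good.not_has231 {X Y : List ℕ} {m : ℕ} (hY : ∀ x ∈ Y, x < m) (h : Good (X ++ m :: Y)) :
    ¬ Has231 Y := by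
  rintro ⟨x, y, z, hs, h1, h2⟩
  refine h.1 ⟨m, x, y, z, ?_, h1, h2, hY _ (hs.subset (by simp))⟩
  exact (hs.cons_cons m).trans (List.sublist_append_right X _)

/-- In a new occurrence `m` must play the 4, leaving a 231 after it or a 312 before it. -/
theorem Good.insert {X Y : List ℕ} {m : ℕ} (hX : ∀ x ∈ X, x < m) (hY : ∀ x ∈ Y, x < m)
    (h : Good (X ++ Y)) (h1 : ¬ Has312 X) (h2 : ¬ Has231 Y) : Good (X ++ m :: Y) := by
  constructor
  · rintro ⟨a, b, c, d, hs, e1, e2, e3⟩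
    rcases sublist_insert hs with hs | ⟨l₁, l₂, hl, hs1, hs2⟩
    · exact h.1 ⟨a, b, c, d, hs, e1, e2, e3⟩
    · have q1 := fun x hx => hX x (hs1.subset hx)
      have q2 := fun x hx => hY x (hs2.subset hx)
      rcases l₁ with _ | ⟨p, _ | ⟨q, _ | ⟨r, _ | ⟨s, l₁⟩⟩⟩⟩ <;> simp at hl
      · obtain ⟨rfl, rfl⟩ := hl
        exact h2 ⟨b, c, d, hs2, e1, e2⟩
      · obtain ⟨rfl, rfl, rfl⟩ := hl
        have := q2 c (by simp); omega
      · obtain ⟨rfl, rfl, rfl, rfl⟩ := hl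
        have := q1 a (by simp); omega
      · obtain ⟨rfl, rfl, rfl, rfl, rfl⟩ := hl
        have := q1 b (by simp); omega
  · rintro ⟨a, b, c, d, hs, e1, e2, e3⟩
    rcases sublist_insert hs with hs | ⟨l₁, l₂, hl, hs1, hs2⟩
    · exact h.2 ⟨a, b, c, d, hs, e1, e2, e3⟩
    · have q1 := fun x hx => hX x (hs1.subset hx)
      have q2 := fun x hx => hY x (hs2.subset hx)
      rcases l₁ with _ | ⟨p, _ | ⟨q, _ | ⟨r, _ | ⟨s, l₁⟩⟩⟩⟩ <;> simp at hl
      · obtain ⟨rfl, rfl⟩ := hl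
        have := q2 d (by simp); omega
      · obtain ⟨rfl, rfl, rfl⟩ := hl
        have := q2 c (by simp); omega
      · obtain ⟨rfl, rfl, rfl, rfl⟩ := hl
        have := q1 a (by simp); omega
      · obtain ⟨rfl, rfl, rfl, rfl, rfl⟩ := hl
        exact h1 ⟨a, b, c, hs1, e1, e2⟩

theorem not_has312_insert {X Y : List ℕ} {m : ℕ} (hX : ∀ x ∈ X, x < m) (hY : ∀ x ∈ Y, x < m)
    (h : ¬ Has312 (X ++ Y)) (hd : Y.Pairwise (· > ·)) : ¬ Has312 (X ++ m :: Y) := by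
  rintro ⟨x, y, z, hs, e1, e2⟩
  rcases sublist_insert hs with hs | ⟨l₁, l₂, hl, hs1, hs2⟩
  · exact h ⟨x, y, z, hs, e1, e2⟩
  · have q1 := fun x hx => hX x (hs1.subset hx)
    have q2 := fun x hx => hY x (hs2.subset hx)
    rcases l₁ with _ | ⟨p, _ | ⟨q, _ | ⟨r, l₁⟩⟩⟩ <;> simp at hl
    · obtain ⟨rfl, rfl⟩ := hl
      have := hd.sublist hs2
      simp at this; omega
    · obtain ⟨rfl, rfl, rfl⟩ := hl
      have := q2 z (by simp); omega
    · obtain ⟨rfl, rfl, rfl, rfl⟩ := hl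
      have := q1 x (by simp); omega

theorem not_has231_insert {X Y : List ℕ} {m : ℕ} (hX : ∀ x ∈ X, x < m) (hY : ∀ x ∈ Y, x < m)
    (h : ¬ Has231 (X ++ Y)) (hd : ∀ x ∈ X, ∀ y ∈ Y, x < y) : ¬ Has231 (X ++ m :: Y) := by
  rintro ⟨x, y, z, hs, e1, e2⟩
  rcases sublist_insert hs with hs | ⟨l₁, l₂, hl, hs1, hs2⟩
  · exact h ⟨x, y, z, hs, e1, e2⟩
  · have q1 := fun x hx => hX x (hs1.subset hx)
    have q2 := fun x hx => hY x (hs2.subset hx)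
    rcases l₁ with _ | ⟨p, _ | ⟨q, _ | ⟨r, l₁⟩⟩⟩ <;> simp at hl
    · obtain ⟨rfl, rfl⟩ := hl
      have := q2 y (by simp); omega
    · obtain ⟨rfl, rfl, rfl⟩ := hl
      have := hd x (hs1.subset (by simp)) z (hs2.subset (by simp)); omega
    · obtain ⟨rfl, rfl, rfl, rfl⟩ := hl
      have := q1 x (by simp); omega

/-- In the word `A ++ W ++ B` with entries below `m`, the places where the new maximum `m` can be
inserted without creating `4231` or `3124` are exactly those in or at an end of `W`. -/
structure Active (m : ℕ) (A W B : List ℕ) : Prop where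
  lt : ∀ x ∈ A ++ W ++ B, x < m
  good : Good (A ++ W ++ B)
  left : ¬ Has312 (A ++ W)
  right : ¬ Has231 (W ++ B)
  lmax : ∀ A' a, A = A' ++ [a] → Has231 (a :: (W ++ B))
  rmax : ∀ b B', B = b :: B' → Has312 (A ++ W ++ [b])

/-- The new active factor ends where `m` first causes an obstruction: on the left, the last entry
`u` of `U` gives a 231 `u m z`; on the right, the first entry `r` of `R` gives a 312 `m t r`. -/
theorem Active.insert {m : ℕ} {A U V T R B : List ℕ} (h : Active m A (U ++ V ++ T ++ R) B)
    (hT : T.Pairwise (· > ·)) (hV : ∀ v ∈ V, ∀ z ∈ T ++ R ++ B, v < z)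
    (hU : U = [] ∨ ∃ U' u z, U = U' ++ [u] ∧ z ∈ T ++ R ++ B ∧ z < u)
    (hR : R = [] ∨ ∃ r R' t, R = r :: R' ∧ t ∈ T ∧ t < r) :
    Active (m + 1) (A ++ U) (V ++ m :: T) (R ++ B) := by
  obtain ⟨lt, good, left, right, lmax, rmax⟩ := h
  simp only [List.mem_append, or_imp, forall_and] at lt
  obtain ⟨⟨lA, ⟨⟨lU, lV⟩, lT⟩, lR⟩, lB⟩ := lt
  have hrw : A ++ U ++ (V ++ m :: T) ++ (R ++ B) = (A ++ U ++ V) ++ m :: (T ++ R ++ B) := by simp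
  constructor
  · have hs {l : List ℕ} (hl : ∀ x ∈ l, x < m) : ∀ x ∈ l, x < m + 1 :=
      fun x hx => (hl x hx).trans m.lt_succ_self
    simp only [List.mem_append, List.mem_cons, or_imp, forall_and, forall_eq]
    exact ⟨⟨⟨hs lA, hs lU⟩, hs lV, m.lt_succ_self, hs lT⟩, hs lR, hs lB⟩
  · rw [hrw]
    refine Good.insert ?_ ?_ (by simpa using good) (fun h => left (h.mono ?_))
      (fun h => right (h.mono ?_))
    · simp only [List.mem_append, or_imp, forall_and]
      exact ⟨⟨lA, lU⟩, lV⟩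
    · simp only [List.mem_append, or_imp, forall_and]
      exact ⟨⟨lT, lR⟩, lB⟩
    · simp
    · simp
  · have := not_has312_insert (X := A ++ U ++ V) (Y := T) (m := m)
      (by simp only [List.mem_append, or_imp, forall_and]; exact ⟨⟨lA, lU⟩, lV⟩)
      lT (fun h => left (h.mono (by simp))) hT
    simpa using this
  · have := not_has231_insert (X := V) (Y := T ++ R ++ B) (m := m)
      lV (by simp only [List.mem_append, or_imp, forall_and]; exact ⟨⟨lT, lR⟩, lB⟩)
      (fun h => right (h.mono (by simp))) hV
    simpa using this
  · intro A' a ha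
    rcases hU with rfl | ⟨U', u, z, rfl, hz, hzu⟩
    · refine (lmax A' a (by simpa using ha)).mono (List.Sublist.cons_cons a ?_)
      simp
    · rw [← List.append_assoc] at ha
      obtain rfl : u = a := by simpa using (List.append_inj' ha rfl).2
      refine ⟨u, m, z, List.Sublist.cons_cons u ?_, hzu, lU u (by simp)⟩
      have : [z].Sublist (T ++ R ++ B) := List.singleton_sublist.2 hz
      rw [show V ++ m :: T ++ (R ++ B) = V ++ m :: (T ++ R ++ B) by simp]
      exact (this.cons_cons m).trans (List.sublist_append_right V _)
  · intro b B' hb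
    rcases hR with rfl | ⟨r, R', t, rfl, ht, htr⟩
    · refine (rmax b B' (by simpa using hb)).mono ?_
      simp
    · simp only [List.cons_append, List.cons.injEq] at hb
      obtain ⟨rfl, -⟩ := hb
      refine ⟨m, t, r, ?_, htr, lR r (by simp)⟩
      have : [t].Sublist T := by simpa using ht
      have := ((this.append (List.Sublist.refl [r])).cons_cons m).trans
        (List.sublist_append_right (A ++ U ++ V) _)
      simpa using this

/-! ### Counting descendants by summing over insertion places. -/

open Classical in
/-- The number of good words obtained from `w` by `k` successive insertions of the new maxima
`m, m + 1, …`, with all intermediate words good. -/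
noncomputable def cnt : ℕ → ℕ → List ℕ → ℚ
  | 0, _, _ => 1
  | k + 1, m, w => ∑ i ∈ range (w.length + 1),
      if Good (w.take i ++ m :: w.drop i) then cnt k (m + 1) (w.take i ++ m :: w.drop i) else 0

open Classical in
/-- The contribution to `cnt (k + 1) m (X ++ Y)` of the insertion between `X` and `Y`. -/
noncomputable def val (k m : ℕ) (X Y : List ℕ) : ℚ :=
  if Good (X ++ m :: Y) then cnt k (m + 1) (X ++ m :: Y) else 0

/-- The sum over all cuts of `X ++ Y ++ Z` to the left of an entry of `Y`. -/
def cutSum (f : List ℕ → List ℕ → ℚ) (X Y Z : List ℕ) : ℚ :=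
  ∑ i ∈ range Y.length, f (X ++ Y.take i) (Y.drop i ++ Z)

theorem cutSum_append (f : List ℕ → List ℕ → ℚ) (X Y₁ Y₂ Z : List ℕ) :
    cutSum f X (Y₁ ++ Y₂) Z = cutSum f X Y₁ (Y₂ ++ Z) + cutSum f (X ++ Y₁) Y₂ Z := by
  unfold cutSum
  rw [List.length_append, sum_range_add]
  congr 1
  · refine sum_congr rfl fun i hi => ?_
    have := mem_range.1 hi
    rw [List.take_append_of_le_length (by omega), List.drop_append_of_le_length (by omega),
      List.append_assoc]
  · refine sum_congr rfl fun i hi => ?_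
    simp [List.take_append, List.drop_append, List.take_of_length_le, List.drop_of_length_le]

theorem cutSum_cons (f : List ℕ → List ℕ → ℚ) (X : List ℕ) (e : ℕ) (Y Z : List ℕ) :
    cutSum f X (e :: Y) Z = f X (e :: (Y ++ Z)) +
      ∑ i ∈ range Y.length, f (X ++ e :: Y.take i) (Y.drop i ++ Z) := by
  unfold cutSum
  rw [List.length_cons, sum_range_succ', add_comm]
  simp

theorem cnt_succ_eq_cutSum (k m : ℕ) (w : List ℕ) :
    cnt (k + 1) m w = cutSum (val k m) [] w [] + val k m w [] := by
  change ∑ i ∈ range (w.length + 1), val k m (w.take i) (w.drop i) = _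
  simp [sum_range_succ, cutSum]

theorem val_eq_zero_of_has231 {k m : ℕ} {X Y : List ℕ} (hY : ∀ x ∈ Y, x < m) (h : Has231 Y) :
    val k m X Y = 0 := if_neg fun hg => hg.not_has231 hY h

theorem val_eq_zero_of_has312 {k m : ℕ} {X Y : List ℕ} (hX : ∀ x ∈ X, x < m) (h : Has312 X) :
    val k m X Y = 0 := if_neg fun hg => hg.not_has312 hX h

/-- Places outside `W` contribute nothing, since the 231 of `lmax` or the 312 of `rmax` persists
further out. -/
theorem Active.cnt_succ {m : ℕ} {A W B : List ℕ} (h : Active m A W B) (k : ℕ) :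
    cnt (k + 1) m (A ++ W ++ B) = cutSum (val k m) A W B + val k m (A ++ W) B := by
  have hlt := h.lt
  have hA : cutSum (val k m) [] A (W ++ B) = 0 := by
    rcases List.eq_nil_or_concat A with rfl | ⟨A', a, rfl⟩
    · rfl
    · refine sum_eq_zero fun i hi => val_eq_zero_of_has231 ?_ ?_
      · intro x hx
        refine hlt x ?_
        rw [List.append_assoc]
        rw [List.mem_append] at hx ⊢
        exact hx.imp_left List.mem_of_mem_drop
      · refine (h.lmax A' a (by simp)).mono ?_
        simp only [List.concat_eq_append, List.length_append, List.length_singleton,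
          mem_range] at hi
        rw [List.concat_eq_append, List.drop_append_of_le_length (by omega)]
        simp
  rw [cnt_succ_eq_cutSum, List.append_assoc, cutSum_append, cutSum_append]
  simp only [List.append_nil, List.nil_append, hA, zero_add]
  rw [add_assoc]
  congr 1
  rcases B with _ | ⟨b, B⟩
  · simp [cutSum]
  · have hb := h.rmax b B rfl
    rw [cutSum_cons, List.append_nil, add_assoc, add_eq_left]
    have hlt' : ∀ x ∈ A ++ (W ++ b :: B), x < m := by simpa using hlt
    rw [val_eq_zero_of_has312 hlt' (hb.mono (by simp)), add_zero]
    refine sum_eq_zero fun i hi => val_eq_zero_of_has312 (fun x hx => hlt' x ?_) (hb.mono ?_)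
    · simp only [List.mem_append, List.mem_cons] at hx ⊢
      have := @List.mem_of_mem_take _ i x B
      tauto
    · simp

/-! ### Open and closed states and their succession rules. -/

/-- `Layered S L`: the word `L` is a direct sum of nonempty decreasing layers, whose sizes are
listed by `S` from the last layer to the first. -/
inductive Layered : List ℕ → List ℕ → Prop
  | nil : Layered [] []
  | snoc {S L D : List ℕ} : Layered S L → D ≠ [] → D.Pairwise (· > ·) →
      (∀ x ∈ L, ∀ d ∈ D, x < d) → Layered (D.length :: S) (L ++ D)

/-- Words all of whose places to the right of the first active one are active: a layered active
part with last layer of size `q`. -/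
def OpenState (m : ℕ) (S : List ℕ) (q : ℕ) (w : List ℕ) : Prop :=
  ∃ A L D, w = A ++ (L ++ D) ∧ Active m A (L ++ D) [] ∧ Layered S L ∧ D.Pairwise (· > ·) ∧
    D.length = q + 1 ∧ ∀ x ∈ L, ∀ d ∈ D, x < d

/-- Words with inactive places on the right: the last layer of the active part consists of
`j + 1` entries exceeding some entry to the right of the active part, then `p` entries below all of
these. -/
def ClosedState (m : ℕ) (S : List ℕ) (p j : ℕ) (w : List ℕ) : Prop :=
  ∃ A L D₁ D₂ B, w = A ++ (L ++ (D₁ ++ D₂)) ++ B ∧ Active m A (L ++ (D₁ ++ D₂)) B ∧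
    Layered S L ∧ (D₁ ++ D₂).Pairwise (· > ·) ∧ D₁.length = j + 1 ∧ D₂.length = p ∧
    (∀ x ∈ L, ∀ z ∈ D₁ ++ D₂ ++ B, x < z) ∧ (∃ b ∈ B, ∀ d ∈ D₁, b < d) ∧
    ∀ d ∈ D₂, ∀ b ∈ B, d < b

theorem val_open {k : ℕ}
    (ih : ∀ m S q w, OpenState m S q w → cnt k m w = coeff k (openSer S (q + 1)))
    {m : ℕ} {A U V T S X W : List ℕ} (h : Active m A W []) (hX : X = A ++ U ++ V)
    (hW : W = U ++ V ++ T) (hT : T.Pairwise (· > ·)) (hS : Layered S V)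
    (hV : ∀ v ∈ V, ∀ z ∈ T, v < z) (hU : U = [] ∨ ∃ U' u z, U = U' ++ [u] ∧ z ∈ T ∧ z < u) :
    val k m X T = coeff k (openSer S (T.length + 1)) := by
  subst hX hW
  have h' : Active m A (U ++ V ++ T ++ []) [] := by simpa using h
  have hI := h'.insert hT (by simpa using hV) (by simpa using hU) (.inl rfl)
  have hg := hI.good
  have e : A ++ U ++ V ++ m :: T = A ++ U ++ (V ++ m :: T) ++ ([] ++ []) := by simp
  rw [val, e, if_pos hg]
  refine ih _ _ _ _ ⟨A ++ U, V, m :: T, by simp, hI, hS, ?_, by simp, ?_⟩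
  · refine List.pairwise_cons.2 ⟨fun t ht => h.lt t (by simp [ht]), hT⟩
  · intro x hx d hd
    rcases List.mem_cons.1 hd with rfl | hd
    · exact h.lt x (by simp [hx])
    · exact hV x hx d hd

/-- The child has last layer `m :: T₁` followed by `T₂`, and inactive right part `R ++ B`. -/
theorem val_closed {k : ℕ}
    (ih : ∀ m S p j w, ClosedState m S p j w → cnt k m w = coeff k (closedSer S p (j + 1)))
    {m : ℕ} {A U V T₁ T₂ R B S X Y W : List ℕ} (h : Active m A W B) (hX : X = A ++ U ++ V)
    (hY : Y = T₁ ++ T₂ ++ R ++ B) (hW : W = U ++ V ++ T₁ ++ T₂ ++ R)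
    (hT : (T₁ ++ T₂).Pairwise (· > ·)) (hS : Layered S V)
    (hV : ∀ v ∈ V, ∀ z ∈ T₁ ++ T₂ ++ R ++ B, v < z)
    (hU : U = [] ∨ ∃ U' u z, U = U' ++ [u] ∧ z ∈ T₁ ++ T₂ ++ R ++ B ∧ z < u)
    (hR : R = [] ∨ ∃ r R' t, R = r :: R' ∧ t ∈ T₁ ++ T₂ ∧ t < r)
    (h₁ : ∃ b ∈ R ++ B, ∀ d ∈ T₁, b < d) (h₂ : ∀ d ∈ T₂, ∀ b ∈ R ++ B, d < b) :
    val k m X Y = coeff k (closedSer S T₂.length (T₁.length + 1)) := by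
  subst hX hY hW
  have h' : Active m A (U ++ V ++ (T₁ ++ T₂) ++ R) B := by simpa using h
  have hI := h'.insert hT hV hU hR
  have hg := hI.good
  have e : A ++ U ++ V ++ m :: (T₁ ++ T₂ ++ R ++ B)
      = A ++ U ++ (V ++ m :: (T₁ ++ T₂)) ++ (R ++ B) := by simp
  rw [val, e, if_pos hg]
  refine ih _ _ _ _ _ ⟨A ++ U, V, m :: T₁, T₂, R ++ B, by simp, hI, hS, ?_, by simp, rfl, ?_, ?_,
    h₂⟩
  · refine List.pairwise_cons.2 ⟨fun t ht => h'.lt t ?_, hT⟩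
    have ht : t ∈ T₁ ++ T₂ := ht
    simp only [List.mem_append] at ht ⊢
    tauto
  · intro x hx d hd
    rcases List.mem_cons.1 hd with rfl | hd
    · exact h.lt x (by simp [hx])
    · exact hV x hx d (by simpa using hd)
  · obtain ⟨b, hb, hbd⟩ := h₁
    refine ⟨b, hb, fun d hd => ?_⟩
    rcases List.mem_cons.1 hd with rfl | hd
    · refine h.lt b ?_
      simp only [List.mem_append] at hb ⊢
      tauto
    · exact hbd d hd

/-- The last entry of a nonempty initial part of a decreasing list exceeds the remaining entries. -/
theorem exists_last_gt {L D E : List ℕ} (hD : D ≠ []) (h : (D ++ E).Pairwise (· > ·)) :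
    ∃ U u, L ++ D = U ++ [u] ∧ u ∈ D ∧ ∀ z ∈ E, z < u := by
  obtain ⟨D, u, rfl⟩ := (List.eq_nil_or_concat D).resolve_left hD
  refine ⟨L ++ D, u, by simp, by simp, fun z hz => ?_⟩
  exact (List.pairwise_append.1 h).2.2 u (by simp) z hz

/-- An insertion into a layer before `W` makes all of `W` inactive, because the first entry of `W`
exceeds that layer. So every such child is closed, with only `m` above the right part, and the total
does not depend on `W`. -/
theorem cutSum_layered {k : ℕ}
    (ih : ∀ m S p j w, ClosedState m S p j w → cnt k m w = coeff k (closedSer S p (j + 1)))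
    {m : ℕ} {A B S L : List ℕ} (hL : Layered S L) : ∀ {W : List ℕ}, W ≠ [] →
    (∀ x ∈ L, ∀ z ∈ W ++ B, x < z) → Active m A (L ++ W) B →
    cutSum (val k m) A L (W ++ B) = coeff k (layerSer S) := by
  induction hL with
  | nil => intro W _ _ _; simp [cutSum, layerSer]
  | @snoc S L D hL hD hdec hLD ihL =>
    intro W hW hlt h
    obtain ⟨e, E, rfl⟩ := List.exists_cons_of_ne_nil hD
    obtain ⟨r, W, rfl⟩ := List.exists_cons_of_ne_nil hW
    have hEr : ∀ d ∈ e :: E, d < r := fun d hd => hlt d (by simp [hd]) r (by simp)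
    rw [cutSum_append, ← List.append_assoc, ihL (by simp) ?_ (by simpa using h), cutSum_cons,
      List.length_cons, layerSer_cons, map_add, map_add, map_sum]
    · congr 2
      · refine val_closed ih (U := []) (V := L) (T₁ := []) (T₂ := e :: E) (R := r :: W) h
          (by simp) (by simp) (by simp) hdec hL ?_ (.inl rfl)
          (.inr ⟨r, W, e, rfl, by simp, hEr e (by simp)⟩) ⟨r, by simp⟩ ?_
        · intro v hv z hz
          simp only [List.nil_append, List.append_assoc] at hz
          rcases List.mem_append.1 hz with hz | hz
          · exact hLD v hv z hz
          · exact hlt v (by simp [hv]) z hz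
        · exact fun d hd b hb => hlt d (by simp only [List.mem_append]; tauto) b hb
      · refine sum_congr rfl fun i hi => ?_
        have hi := mem_range.1 hi
        have hsplit : e :: E = e :: E.take i ++ E.drop i := by simp
        rw [hsplit] at hdec
        obtain ⟨U, u, hU, -, hu⟩ := exists_last_gt (L := L) (by simp) hdec
        obtain ⟨t, ht⟩ : ∃ t, t ∈ E.drop i := List.exists_mem_of_ne_nil _ (by simp; omega)
        have hsub : ∀ d ∈ E.drop i, d ∈ e :: E := fun d hd =>
          List.mem_cons_of_mem _ (List.mem_of_mem_drop hd)
        have := val_closed ih (U := L ++ e :: E.take i) (V := []) (T₁ := []) (T₂ := E.drop i)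
          (R := r :: W) (X := A ++ L ++ e :: E.take i) (Y := E.drop i ++ (r :: W ++ B)) h
          (by simp) (by simp) (by simp) (List.pairwise_append.1 hdec).2.1 .nil (by simp)
          (.inr ⟨U, u, t, hU, by simp [ht], hu t ht⟩)
          (.inr ⟨r, W, t, rfl, by simpa using ht, hEr t (hsub t ht)⟩) ⟨r, by simp⟩
          (fun d hd b hb => hlt d (List.mem_append_right _ (hsub d hd)) b hb)
        simpa using this
    · intro x hx z hz
      rw [List.append_assoc] at hz
      rcases List.mem_append.1 hz with hz | hz
      · exact hLD x hx z hz
      · exact hlt x (by simp [hx]) z hz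

theorem cnt_succ_open {k : ℕ}
    (iho : ∀ m S q w, OpenState m S q w → cnt k m w = coeff k (openSer S (q + 1)))
    (ihc : ∀ m S p j w, ClosedState m S p j w → cnt k m w = coeff k (closedSer S p (j + 1)))
    {m : ℕ} {S : List ℕ} {q : ℕ} {w : List ℕ} (h : OpenState m S q w) :
    cnt (k + 1) m w = coeff (k + 1) (openSer S (q + 1)) := by
  obtain ⟨A, L, D, rfl, hA, hL, hdec, hq, hLD⟩ := h
  obtain ⟨e, E, rfl⟩ : ∃ e E, D = e :: E := List.exists_cons_of_length_eq_add_one hq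
  obtain rfl : E.length = q := by simpa using hq
  have h1 := cutSum_layered ihc hL (W := e :: E) (B := []) (by simp) (by simpa using hLD) hA
  have h2 : val k m (A ++ L) (e :: E) = coeff k (openSer S (E.length + 2)) :=
    val_open iho (U := []) (V := L) hA (by simp) (by simp) hdec hL hLD (.inl rfl)
  have h3 : val k m (A ++ (L ++ e :: E)) [] = coeff k (openSer ((E.length + 1) :: S) 1) :=
    val_open iho (U := []) (V := L ++ e :: E) (T := []) hA (by simp) (by simp) (by simp)
      (.snoc hL (by simp) hdec hLD) (by simp) (.inl rfl)
  have h4 : ∀ i ∈ range E.length, val k m (A ++ L ++ e :: E.take i) (E.drop i ++ []) =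
      coeff k (openSer [] (E.length - i + 1)) := by
    intro i hi
    have hi := mem_range.1 hi
    have hsplit : e :: E = e :: E.take i ++ E.drop i := by simp
    rw [hsplit] at hdec
    obtain ⟨U, u, hU, -, hu⟩ := exists_last_gt (L := L) (by simp) hdec
    obtain ⟨t, ht⟩ : ∃ t, t ∈ E.drop i := List.exists_mem_of_ne_nil _ (by simp; omega)
    have := val_open iho (U := L ++ e :: E.take i) (V := []) (T := E.drop i)
      (X := A ++ L ++ e :: E.take i) hA (by simp) (by simp) (List.pairwise_append.1 hdec).2.1 .nil
      (by simp) (.inr ⟨U, u, t, hU, ht, hu t ht⟩)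
    simpa using this
  have h0 := hA.cnt_succ k
  rw [cutSum_append, cutSum_cons, h1, List.append_nil, List.append_nil, h2, h3,
    sum_congr rfl h4] at h0
  rw [h0, openSer_eq S E.length, map_add (coeff (k + 1)), coeff_one, if_neg k.succ_ne_zero, zero_add, coeff_succ_X_mul]
  simp only [map_add, map_sum]
  ring

theorem cnt_succ_closed {k : ℕ}
    (ihc : ∀ m S p j w, ClosedState m S p j w → cnt k m w = coeff k (closedSer S p (j + 1)))
    {m : ℕ} {S : List ℕ} {p j : ℕ} {w : List ℕ} (h : ClosedState m S p j w) :
    cnt (k + 1) m w = coeff (k + 1) (closedSer S p (j + 1)) := by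
  obtain ⟨A, L, D₁, D₂, B, rfl, hA, hL, hdec, hj, rfl, hlt, ⟨b, hbB, hb⟩, hD₂⟩ := h
  obtain ⟨e, E, rfl⟩ : ∃ e E, D₁ = e :: E := List.exists_cons_of_length_eq_add_one hj
  obtain rfl : E.length = j := by simpa using hj
  have h1 := cutSum_layered ihc hL (W := e :: E ++ D₂) (B := B) (by simp) hlt hA
  have h2 : val k m (A ++ L) (e :: (E ++ (D₂ ++ B))) =
      coeff k (closedSer S D₂.length (E.length + 2)) :=
    val_closed ihc (U := []) (V := L) (T₁ := e :: E) (T₂ := D₂) (R := []) hA (by simp) (by simp)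
      (by simp) hdec hL (by simpa using hlt) (.inl rfl) (.inl rfl) ⟨b, hbB, hb⟩ hD₂
  -- Entries of `D₁` exceed `b`, so they become inactive, while `D₂` lies below `B` and survives as
  -- the only earlier layer, if nonempty.
  have h3 : val k m (A ++ (L ++ (e :: E ++ D₂))) B =
      coeff k (closedSer (if D₂.length = 0 then [] else [D₂.length]) 0 1) := by
    obtain ⟨U, u, hU, hu, -⟩ := exists_last_gt (L := L) (by simp) hdec
    have hS : Layered (if D₂.length = 0 then [] else [D₂.length]) D₂ := by
      split_ifs with h
      · rw [List.length_eq_zero_iff.1 h]; exact .nil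
      · exact .snoc (L := []) .nil (by simpa using h) (List.pairwise_append.1 hdec).2.1 (by simp)
    exact val_closed ihc (U := L ++ e :: E) (V := D₂) (T₁ := []) (T₂ := []) (R := []) hA (by simp)
      (by simp) (by simp) (by simp) hS (by simpa using hD₂)
      (.inr ⟨U, u, b, hU, by simpa using hbB, hb u hu⟩) (.inl rfl) ⟨b, hbB, by simp⟩ (by simp)
  have h4 : ∀ i ∈ range E.length, val k m (A ++ L ++ e :: E.take i) (E.drop i ++ (D₂ ++ B)) =
      coeff k (closedSer [] D₂.length (E.length - i + 1)) := by
    intro i hi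
    have hi := mem_range.1 hi
    have hsplit : e :: E ++ D₂ = e :: E.take i ++ (E.drop i ++ D₂) := by
      rw [← List.append_assoc]; simp
    rw [hsplit] at hdec
    obtain ⟨U, u, hU, hu, -⟩ := exists_last_gt (L := L) (by simp) hdec
    have hub : b < u := hb u (List.mem_of_mem_take (i := i + 1) (by simpa using hu))
    have := val_closed ihc (U := L ++ e :: E.take i) (V := []) (T₁ := E.drop i) (T₂ := D₂)
      (R := []) (X := A ++ L ++ e :: E.take i) (Y := E.drop i ++ (D₂ ++ B)) hA
      (by simp) (by simp) (by rw [hsplit]; simp only [List.append_assoc, List.append_nil])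
      (List.pairwise_append.1 hdec).2.1 .nil (by simp)
      (.inr ⟨U, u, b, hU, by simp [hbB], hub⟩) (.inl rfl)
      ⟨b, hbB, fun d hd => hb d (List.mem_cons_of_mem _ (List.mem_of_mem_drop hd))⟩ hD₂
    simpa using this
  have h5 : cutSum (val k m) (A ++ L ++ e :: E) D₂ B =
      ∑ i ∈ range D₂.length, coeff k (closedSer [] (D₂.length - i) 1) := by
    refine sum_congr rfl fun i hi => ?_
    have hsplit : e :: E ++ D₂ = e :: E ++ D₂.take i ++ D₂.drop i := by simp
    have hdec' := (List.pairwise_append.1 hdec).2.1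
    rw [hsplit] at hdec
    obtain ⟨U, u, hU, -, hu⟩ := exists_last_gt (L := L) (by simp) hdec
    obtain ⟨t, ht⟩ : ∃ t, t ∈ D₂.drop i :=
      List.exists_mem_of_ne_nil _ (by have := mem_range.1 hi; simp; omega)
    have := val_closed ihc (U := L ++ (e :: E ++ D₂.take i)) (V := []) (T₁ := [])
      (T₂ := D₂.drop i) (R := []) (X := A ++ L ++ e :: E ++ D₂.take i) (Y := D₂.drop i ++ B) hA
      (by simp) (by simp) (by simp) (hdec'.sublist (List.drop_sublist i D₂)) .nil (by simp)
      (.inr ⟨U, u, t, hU, by simp [ht], hu t ht⟩) (.inl rfl) ⟨b, hbB, by simp⟩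
      (fun d hd => hD₂ d (List.mem_of_mem_drop hd))
    simpa using this
  have h0 := hA.cnt_succ k
  rw [cutSum_append, h1, cutSum_append, cutSum_cons, h2, h3, sum_congr rfl h4, h5] at h0
  rw [h0, closedSer_eq S D₂.length E.length, map_add (coeff (k + 1)), coeff_one, if_neg k.succ_ne_zero, zero_add, coeff_succ_X_mul]
  simp only [map_add, map_sum]
  ring

theorem cnt_closed (k : ℕ) : ∀ m S p j w, ClosedState m S p j w →
    cnt k m w = coeff k (closedSer S p (j + 1)) := by
  induction k with
  | zero => intro m S p j w _; rw [closedSer_eq]; simp [cnt]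
  | succ k ih => exact fun m S p j w h => cnt_succ_closed ih h

theorem cnt_open (k : ℕ) : ∀ m S q w, OpenState m S q w →
    cnt k m w = coeff k (openSer S (q + 1)) := by
  induction k with
  | zero => intro m S q w _; rw [openSer_eq]; simp [cnt]
  | succ k ih => exact fun m S q w h => cnt_succ_open ih (cnt_closed k) h

theorem active_singleton : Active 1 [] [0] [] := by
  have h {l : List ℕ} (hl : l.Sublist [0]) : l.length ≤ 1 := hl.length_le
  refine ⟨by simp, ⟨?_, ?_⟩, ?_, ?_, by simp, by simp⟩
  · rintro ⟨a, b, c, d, hs, -⟩; simpa using h hs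
  · rintro ⟨a, b, c, d, hs, -⟩; simpa using h hs
  · rintro ⟨a, b, c, hs, -⟩; simpa using h hs
  · rintro ⟨a, b, c, hs, -⟩; simpa using h hs

theorem openState_singleton : OpenState 1 [] 0 [0] :=
  ⟨[], [], [0], rfl, active_singleton, .nil, by simp, rfl, by simp⟩

theorem cnt_singleton (k : ℕ) : cnt k 1 [0] = coeff k (openSer [] 1) :=
  cnt_open k _ _ _ _ openState_singleton

/-! ### From permutations to words, and the count of each level of the tree. -/

/-- The one-line notation of a permutation. -/
def word {n : ℕ} (π : Equiv.Perm (Fin n)) : List ℕ := List.ofFn fun i => (π i : ℕ)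

theorem word_injective (n : ℕ) : Function.Injective (word (n := n)) := by
  intro π ρ h
  ext i
  exact congrFun (List.ofFn_injective h) i

theorem exists_sublist_word_iff {n k : ℕ} (π : Equiv.Perm (Fin n)) (v : Fin k → ℕ) :
    (List.ofFn v).Sublist (word π) ↔ ∃ e : Fin k ↪o Fin n, ∀ i, v i = π (e i) := by
  rw [List.sublist_iff_exists_fin_orderEmbedding_get_eq]
  have hk : (List.ofFn v).length = k := List.length_ofFn
  have hn : (word π).length = n := List.length_ofFn
  constructor
  · rintro ⟨f, hf⟩
    refine ⟨((Fin.castOrderIso hk.symm).toOrderEmbedding.trans f).trans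
      (Fin.castOrderIso hn).toOrderEmbedding, fun i => ?_⟩
    have := hf (Fin.cast hk.symm i)
    simp [word] at this
    exact this
  · rintro ⟨e, he⟩
    refine ⟨((Fin.castOrderIso hk).toOrderEmbedding.trans e).trans
      (Fin.castOrderIso hn.symm).toOrderEmbedding, fun i => ?_⟩
    have := he (Fin.cast hk i)
    simp only [word, List.get_eq_getElem, List.getElem_ofFn] at this ⊢
    exact this

theorem permContains_4231_iff {n : ℕ} (π : Equiv.Perm (Fin n)) :
    PermContains π perm4231 ↔ Has4231 (word π) := by
  constructor
  · rintro ⟨e, he⟩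
    refine ⟨π (e 0), π (e 1), π (e 2), π (e 3), ?_, (he 3 1).2 (by decide), (he 1 2).2 (by decide),
      (he 2 0).2 (by decide)⟩
    have := (exists_sublist_word_iff π fun i => (π (e i) : ℕ)).2 ⟨e, fun _ => rfl⟩
    simpa [List.ofFn_succ] using this
  · rintro ⟨a, b, c, d, hs, h1, h2, h3⟩
    obtain ⟨e, he⟩ := (exists_sublist_word_iff π ![a, b, c, d]).1 (by simpa [List.ofFn_succ] using hs)
    refine ⟨e, fun i j => ?_⟩
    rw [Fin.lt_def, ← he, ← he]
    fin_cases i <;> fin_cases j <;> simp [perm4231] <;> omega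

theorem permContains_3124_iff {n : ℕ} (π : Equiv.Perm (Fin n)) :
    PermContains π perm3124 ↔ Has3124 (word π) := by
  constructor
  · rintro ⟨e, he⟩
    refine ⟨π (e 0), π (e 1), π (e 2), π (e 3), ?_, (he 1 2).2 (by decide), (he 2 0).2 (by decide),
      (he 0 3).2 (by decide)⟩
    have := (exists_sublist_word_iff π fun i => (π (e i) : ℕ)).2 ⟨e, fun _ => rfl⟩
    simpa [List.ofFn_succ] using this
  · rintro ⟨a, b, c, d, hs, h1, h2, h3⟩
    obtain ⟨e, he⟩ := (exists_sublist_word_iff π ![a, b, c, d]).1 (by simpa [List.ofFn_succ] using hs)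
    refine ⟨e, fun i j => ?_⟩
    rw [Fin.lt_def, ← he, ← he]
    fin_cases i <;> fin_cases j <;> simp [perm3124] <;> omega

theorem mem_av_iff {n : ℕ} (π : Equiv.Perm (Fin n)) :
    π ∈ Av {⟨4, perm4231⟩, ⟨4, perm3124⟩} n ↔ Good (word π) := by
  simp [Av, Good, permContains_4231_iff, permContains_3124_iff]

open Classical in
/-- The good words with entries `0, …, n - 1`. -/
noncomputable def level (n : ℕ) : Finset (List ℕ) :=
  (List.range n).permutations.toFinset.filter Good

theorem mem_level {n : ℕ} {w : List ℕ} : w ∈ level n ↔ w.Perm (List.range n) ∧ Good w := by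
  simp [level]

theorem word_perm_range {n : ℕ} (π : Equiv.Perm (Fin n)) : (word π).Perm (List.range n) := by
  refine (List.perm_ext_iff_of_nodup ?_ List.nodup_range).2 fun a => ?_
  · exact List.nodup_ofFn.2 (Fin.val_injective.comp π.injective)
  · simp only [word, List.mem_ofFn, List.mem_range]
    constructor
    · rintro ⟨i, rfl⟩; exact (π i).2
    · intro h; exact ⟨π.symm ⟨a, h⟩, by simp⟩

theorem exists_word_eq {n : ℕ} {w : List ℕ} (h : w.Perm (List.range n)) :
    ∃ π : Equiv.Perm (Fin n), word π = w := by
  have hl : w.length = n := by simpa using h.length_eq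
  have hn : w.Nodup := h.nodup_iff.2 List.nodup_range
  have hm : ∀ i (hi : i < w.length), w[i] < n := fun i hi => by
    simpa using h.mem_iff.1 (List.getElem_mem hi)
  let f : Fin n → Fin n := fun i => ⟨w[i]'(by omega), hm i (by omega)⟩
  have hf : Function.Injective f := fun i j hij =>
    Fin.ext ((hn.getElem_inj_iff).1 (Fin.mk.inj_iff.1 hij))
  refine ⟨Equiv.ofBijective f (Finite.injective_iff_bijective.1 hf), ?_⟩
  refine List.ext_getElem (by simp [word, hl]) fun i h1 h2 => ?_
  simp [word, f]

theorem ncard_av (n : ℕ) :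
    (Av {⟨4, perm4231⟩, ⟨4, perm3124⟩} n).ncard = #(level n) := by
  rw [← Set.ncard_image_of_injective _ (word_injective n), ← Set.ncard_coe_finset]
  congr 1
  ext w
  simp only [Set.mem_image, Finset.mem_coe, mem_level, mem_av_iff]
  constructor
  · rintro ⟨π, h, rfl⟩; exact ⟨word_perm_range π, h⟩
  · rintro ⟨hw, h⟩
    obtain ⟨π, rfl⟩ := exists_word_eq hw
    exact ⟨π, h, rfl⟩

theorem perm_range_insert {n : ℕ} {X Y : List ℕ} :
    (X ++ n :: Y).Perm (List.range (n + 1)) ↔ (X ++ Y).Perm (List.range n) := by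
  rw [List.perm_middle.congr_left, List.range_succ, (List.perm_append_singleton n _).congr_right,
    List.perm_cons]

/-- Deleting the maximum of a good word leaves a good word, so each word of the next level arises
from exactly one insertion. -/
theorem sum_level_cnt_succ (n k : ℕ) :
    ∑ w ∈ level n, cnt (k + 1) n w = ∑ w ∈ level (n + 1), cnt k (n + 1) w := by
  classical
  have e : ∀ w ∈ level n, cnt (k + 1) n w = ∑ i ∈ range (n + 1),
      if Good (w.take i ++ n :: w.drop i) then cnt k (n + 1) (w.take i ++ n :: w.drop i) else 0 := by
    intro w hw
    have hl : w.length = n := by simpa using (mem_level.1 hw).1.length_eq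
    rw [cnt, hl]
  rw [sum_congr rfl e, ← sum_product', ← sum_filter]
  refine sum_bij (fun p _ => p.1.take p.2 ++ n :: p.1.drop p.2) ?_ ?_ ?_ (fun _ _ => rfl)
  · rintro ⟨w, i⟩ h
    simp only [mem_filter, mem_product, mem_level] at h ⊢
    exact ⟨perm_range_insert.2 (by simpa using h.1.1.1), h.2⟩
  -- Erasing `n` and recording its index inverts the insertion.
  · have key : ∀ p ∈ ((level n ×ˢ range (n + 1)).filter fun p =>
        Good (p.1.take p.2 ++ n :: p.1.drop p.2)),
        ((p.1.take p.2 ++ n :: p.1.drop p.2).erase n,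
          (p.1.take p.2 ++ n :: p.1.drop p.2).idxOf n) = p := by
      rintro ⟨w, i⟩ h
      simp only [mem_filter, mem_product, mem_level, mem_range] at h
      have hl : w.length = n := by simpa using h.1.1.1.length_eq
      have hn : n ∉ w.take i := fun hn => by
        simpa using h.1.1.1.mem_iff.1 (List.mem_of_mem_take hn)
      simp only [Prod.mk.injEq]
      constructor
      · rw [List.erase_append_right _ hn]; simp
      · rw [List.idxOf_append_of_notMem hn]; simp; omega
    intro p hp q hq hpq
    rw [← key p hp, ← key q hq, hpq]
  · intro w hw
    obtain ⟨hp, hg⟩ := mem_level.1 hw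
    obtain ⟨X, Y, rfl⟩ := List.append_of_mem (hp.mem_iff.2 (by simp : n ∈ List.range (n + 1)))
    have hp := perm_range_insert.1 hp
    have hl : X.length + Y.length = n := by simpa using hp.length_eq
    refine ⟨(X ++ Y, X.length), ?_, by simp⟩
    simp only [mem_filter, mem_product, mem_level, mem_range]
    exact ⟨⟨⟨hp, hg.anti (append_sublist_insert X Y n)⟩, by omega⟩, by simpa using hg⟩

theorem sum_level_cnt (k : ℕ) : ∀ n, ∑ w ∈ level n, cnt k n w = #(level (n + k)) := by
  induction k with
  | zero => intro n; simp [cnt]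
  | succ k ih => intro n; rw [sum_level_cnt_succ, ih, Nat.add_right_comm, Nat.add_assoc]

theorem level_one : level 1 = {[0]} := by
  ext w
  simp only [mem_level, mem_singleton, List.range_one, List.perm_singleton]
  exact ⟨fun h => h.1, fun h => ⟨h, h ▸ active_singleton.good⟩⟩

theorem avGenFun_eq : avGenFun {⟨4, perm4231⟩, ⟨4, perm3124⟩} = X * openSer [] 1 := by
  ext n
  rw [avGenFun, coeff_mk]
  rcases n with _ | k
  · simp
  · rw [if_neg (by omega), coeff_succ_X_mul, ← cnt_singleton, ncard_av, Nat.add_comm k 1,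
      ← sum_level_cnt, level_one, sum_singleton]

end AvTree

open PowerSeries in
theorem theorem5p2 :
    ∃ s : PowerSeries ℚ, constantCoeff s = 1 ∧ s ^ 2 = 1 - 4 * X ∧
      avGenFun {⟨4, perm4231⟩, ⟨4, perm3124⟩} =
        (1 - 8 * X + 20 * X ^ 2 - 20 * X ^ 3 + 10 * X ^ 4 - 2 * X ^ 5
            - (1 - 4 * X + 2 * X ^ 2) * s) *
          (2 * (1 - 3 * X + X ^ 2) * (-1 + 5 * X - 4 * X ^ 2 + X ^ 3))⁻¹ := by
  refine ⟨1 - 2 * X * AvTree.cat, by simp, ?_, ?_⟩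
  · linear_combination -4 * X * AvTree.cat_eq
  -- What remains is that the denominator is invertible: its constant term is `-2`.
  · rw [PowerSeries.eq_mul_inv_iff_mul_eq, AvTree.avGenFun_eq, AvTree.closed_form]
    have : constantCoeff (2 : PowerSeries ℚ) = 2 := map_ofNat _ 2
    simp [this]
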